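/- Let $N=\{1,\dots,n\}$ be a set of players, let $m=2^n-1$ be the number of nonempty coalitions $S\subseteq N$, and index the coordinates of $\mathbb R^m$ by the coalitions. Let $B_{\mathcal H}\in\mathbb R^{m\times n}$ be the matrix whose row $S$ is the characteristic vector of $S$, and let $B=\left[B_{\mathcal H}\ \Big|\ \begin{smallmatrix}-I_{m-1}\\ 0\end{smallmatrix}\right]\in\mathbb R^{m\times(n+m-1)}$, where the zero row belongs to the grand coalition $N$. For $a_{min},a_{max}\in\mathbb R^n$ let $U=\{u=(a,s)\in\mathbb R^n\times\mathbb R^{m-1}: a_{min}\le a\le a_{max},\ s\ge 0\}$. Let $(v(t))_{t\ge 0}$ be a (jointly measurable) bounded mean ergodic process: there are a bounded convex set $\mathcal V\subset\mathbb R^m$ and a probability measure $\mathbb P$ on $\mathcal V$ such that $v(t)$ has law $\mathbb P$ for every $t\ge0$, and, for a vector $v_{nom}\in\mathbb R^m$, $\mathbb E[v(t)]=v_{nom}$ for every $t\ge 0$ and $\lim_{T\to\infty}\frac1T\int_0^T v(\tau)\,d\tau=v_{nom}$ with probability one. Let $u_{nom}$ satisfy $Bu_{nom}=v_{nom}$,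 let $B^\dagger$ be a pseudo-inverse of $B$ (that is, $BB^\dagger B=B$; as $B$ has full row rank, equivalently $BB^\dagger=I$), and let $\delta>0$ be such that the control $$\hat\phi(\mathrm{sgn}(y))=u_{nom}-\delta B^\dagger\,\mathrm{sgn}(y)$$ lies in $U$ for every $y\in\mathbb R^m$, where $\mathrm{sgn}$ is taken componentwise and $\mathrm{sgn}(0)=0$. Let $(x(t))_{t\ge0}$ be an $\mathbb R^m$-valued random process whose paths are, with probability one, solutions in the sense of Filippov of $$\dot x(t)=B\,\hat\phi(\mathrm{sgn}(x(t)))-v(t),\qquad t\ge 0,$$ and suppose that for every $t\ge 0$ the state $x(t)$ and the fluctuation $\Delta v(t)=v(t)-v_{nom}$ are independent. Then $$\lim_{t\to\infty}x(t)=0\quad\text{with probability one.}$$ -/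

import Mathlib

open MeasureTheory ProbabilityTheory Filter Topology Matrix

noncomputable section

/-- The coalitions of the players `1, …, n`: the nonempty sets of players
(there are `m = 2 ^ n - 1` of them). -/
abbrev Coalition (n : ℕ) : Type := {S : Finset (Fin n) // S.Nonempty}

/-- The coalitions other than the grand coalition. -/
abbrev ProperCoalition (n : ℕ) : Type := {S : Coalition n // S.1 ≠ Finset.univ}

/-- The control vector `u = (a, s)` has one coordinate `a_i` (allocation) per player and one
coordinate `s_S` (surplus) per coalition other than the grand coalition. -/
abbrev ControlIndex (n : ℕ) : Type := Fin n ⊕ ProperCoalition n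

/-- The incidence matrix `B_ℋ`, whose rows are the characteristic vectors of the coalitions. -/
def incidenceMatrix (n : ℕ) : Matrix (Coalition n) (Fin n) ℝ :=
  Matrix.of fun S i => if i ∈ S.1 then 1 else 0

/-- The block `(-I ; 0)`: minus the identity on the rows of the coalitions other than the grand
coalition, and zero on the row of the grand coalition. -/
def surplusMatrix (n : ℕ) : Matrix (Coalition n) (ProperCoalition n) ℝ :=
  Matrix.of fun S T => if S = T.1 then -1 else 0

/-- The matrix `B = [B_ℋ | (-I ; 0)]` of the flow dynamics. -/
def flowMatrix (n : ℕ) : Matrix (Coalition n) (ControlIndex n) ℝ :=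
  Matrix.fromCols (incidenceMatrix n) (surplusMatrix n)

/-- `G` is a (generic) pseudo-inverse of `A`: `A G A = A`. For a matrix of full row rank such as
`flowMatrix n` this says the same as `A G = I`. -/
def IsPseudoInverse {ι κ : Type*} [Fintype ι] [Fintype κ]
    (A : Matrix ι κ ℝ) (G : Matrix κ ι ℝ) : Prop :=
  A * G * A = A

/-- The set `U` of feasible controls `u = (a, s)`: `a` lies in the box `[amin, amax]`
and `s ≥ 0`. -/
def feasibleControls {n : ℕ} (amin amax : Fin n → ℝ) : Set (ControlIndex n → ℝ) :=
  {u | (∀ i, amin i ≤ u (Sum.inl i) ∧ u (Sum.inl i) ≤ amax i) ∧ ∀ T, 0 ≤ u (Sum.inr T)}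

/-- The componentwise sign, with `sgn 0 = 0`. -/
def sgnVec {ι : Type*} (x : ι → ℝ) : ι → ℝ := fun i => Real.sign (x i)

/-- The controller `u_nom - δ B† sgn(x)`, which depends on the sign of `x` only. -/
def signControl {n : ℕ} (unom : ControlIndex n → ℝ) (δ : ℝ)
    (Bdag : Matrix (ControlIndex n) (Coalition n) ℝ) (x : Coalition n → ℝ) :
    ControlIndex n → ℝ :=
  unom - δ • (Bdag *ᵥ sgnVec x)

/-- `v` is a bounded mean ergodic process with values in the bounded convex set `V`: at all times
`t ≥ 0` the random vector `v t` has one and the same law, carried by `V`, its expected value is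
`vnom`, and with probability one the time averages `(1 / T) ∫₀ᵀ v` converge to `vnom`. -/
structure IsBoundedMeanErgodic {Ω : Type*} [MeasurableSpace Ω] (μ : Measure Ω)
    {ι : Type*} [Fintype ι] (V : Set (ι → ℝ)) (v : ℝ → Ω → ι → ℝ) (vnom : ι → ℝ) : Prop where
  bounded : Bornology.IsBounded V
  convex : Convex ℝ V
  measurable : Measurable (Function.uncurry v)
  law : ∃ P : Measure (ι → ℝ), IsProbabilityMeasure P ∧ (∀ᵐ w ∂P, w ∈ V) ∧
    ∀ t, 0 ≤ t → μ.map (v t) = P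
  mean : ∀ t, 0 ≤ t → ∫ ω, v t ω ∂μ = vnom
  ergodic : ∀ᵐ ω ∂μ, Tendsto (fun T : ℝ => T⁻¹ • ∫ τ in (0 : ℝ)..T, v τ ω) atTop (𝓝 vnom)

/-- The Filippov regularization of a vector field `f` at the point `x`: the intersection of the
closed convex hulls of `f (B(x, ρ) \ N)` over all radii `ρ > 0` and all Lebesgue null sets `N`. -/
def filippovSet {ι : Type*} [Fintype ι] (f : (ι → ℝ) → ι → ℝ) (x : ι → ℝ) : Set (ι → ℝ) :=
  ⋂ (ρ : ℝ) (_ : 0 < ρ) (N : Set (ι → ℝ)) (_ : volume N = 0),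
    closure (convexHull ℝ (f '' (Metric.ball x ρ \ N)))

/-- `x` is a Filippov solution on `[0, ∞)` of `ẋ(t) = f(t, x(t))`: it is absolutely continuous on
compact intervals, and for almost every `t ≥ 0` its derivative at `t` lies in the Filippov
regularization of `f t` at `x t`. -/
def IsFilippovSolution {ι : Type*} [Fintype ι] (f : ℝ → (ι → ℝ) → ι → ℝ) (x : ℝ → ι → ℝ) :
    Prop :=
  (∀ T : ℝ, 0 < T → AbsolutelyContinuousOnInterval x 0 T) ∧
  ∀ᵐ t ∂(volume.restrict (Set.Ici (0 : ℝ))), ∃ w ∈ filippovSet (f t) (x t), HasDerivAt x w t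

end

/-! Since `flowMatrix n` has full row rank, B B† = I and the closed loop decouples: each coordinate
solves ẏ ∈ -w - δ Sgn y, with w a coordinate of v - vnom. Let L(y) = -1/(1 + y²). Along a path,
L(y)' = -δ|L'(y)| - L'(y) w. In expectation the cross term vanishes, as w is centred and independent
of y at each time; L takes values in [-1, 0], so δ E∫|L'(y)| ≤ 1 (`integrable_abs_lyapunovDeriv`). A
bounded L needs no moments of x(0), but L' also vanishes at infinity. Hence almost surely |L'(y)| is
integrable in time, and it tends to 0 by Barbalat. So y tends to 0 or escapes to ±∞. Escape would
keep the sign of y fixed, pushing the time averages of w away from 0, against ergodicity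
(`not_eventually_pos`). -/

noncomputable section

/-! ### Bounded Lyapunov function -/

/-- A bounded Lyapunov function on the line, minimal exactly at the origin. -/
def lyapunov (y : ℝ) : ℝ := -(1 + y ^ 2)⁻¹

/-- The derivative of `lyapunov`. -/
def lyapunovDeriv (y : ℝ) : ℝ := 2 * y / (1 + y ^ 2) ^ 2

lemma hasDerivAt_lyapunov (y : ℝ) : HasDerivAt lyapunov (lyapunovDeriv y) y := by
  have h : HasDerivAt (fun y : ℝ => 1 + y ^ 2) (2 * y) y := by
    simpa using (hasDerivAt_pow 2 y).const_add 1
  have h' := (h.inv (by positivity)).neg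
  refine h'.congr_deriv ?_
  rw [lyapunovDeriv]; ring

lemma lyapunov_nonpos (y : ℝ) : lyapunov y ≤ 0 := by
  rw [lyapunov, neg_nonpos]; positivity

lemma neg_one_le_lyapunov (y : ℝ) : -1 ≤ lyapunov y := by
  rw [lyapunov, neg_le_neg_iff]
  exact inv_le_one_of_one_le₀ (by nlinarith [sq_nonneg y])

lemma abs_lyapunovDeriv (y : ℝ) : |lyapunovDeriv y| = 2 * |y| / (1 + y ^ 2) ^ 2 := by
  rw [lyapunovDeriv, abs_div, abs_mul, abs_two, abs_of_nonneg (by positivity : 0 ≤ (1 + y ^ 2) ^ 2)]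

lemma abs_lyapunovDeriv_le_one (y : ℝ) : |lyapunovDeriv y| ≤ 1 := by
  rw [abs_lyapunovDeriv, div_le_one (by positivity), ← sq_abs y]
  nlinarith [sq_nonneg (|y| - 1), sq_nonneg (|y| ^ 2)]

lemma lyapunovDeriv_mul_sign (y : ℝ) : lyapunovDeriv y * Real.sign y = |lyapunovDeriv y| := by
  rw [abs_lyapunovDeriv, lyapunovDeriv, div_mul_eq_mul_div, mul_assoc]
  congr 2
  rcases lt_trichotomy y 0 with h | rfl | h
  · rw [Real.sign_of_neg h, abs_of_neg h]; ring
  · simp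
  · rw [Real.sign_of_pos h, abs_of_pos h]; ring

lemma lipschitzWith_lyapunov : LipschitzWith 1 lyapunov :=
  lipschitzWith_of_nnnorm_deriv_le (fun y => (hasDerivAt_lyapunov y).differentiableAt) fun y => by
    rw [(hasDerivAt_lyapunov y).deriv, ← NNReal.coe_le_coe]
    exact abs_lyapunovDeriv_le_one y

lemma hasDerivAt_lyapunovDeriv (y : ℝ) :
    HasDerivAt lyapunovDeriv ((2 - 6 * y ^ 2) / (1 + y ^ 2) ^ 3) y := by
  have h : HasDerivAt (fun y : ℝ => 1 + y ^ 2) (2 * y) y := by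
    simpa using (hasDerivAt_pow 2 y).const_add 1
  have h2 : HasDerivAt (fun y : ℝ => (1 + y ^ 2) ^ 2) (2 * (1 + y ^ 2) * (2 * y)) y := by
    simpa using h.fun_pow 2
  have h' := ((hasDerivAt_id y).const_mul 2).div h2 (by positivity)
  refine h'.congr_deriv ?_
  have : 1 + y ^ 2 ≠ 0 := by positivity
  simp only [id]
  field_simp
  ring

lemma lipschitzWith_lyapunovDeriv : LipschitzWith 6 lyapunovDeriv :=
  lipschitzWith_of_nnnorm_deriv_le (fun y => (hasDerivAt_lyapunovDeriv y).differentiableAt)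
    fun y => by
      rw [(hasDerivAt_lyapunovDeriv y).deriv, ← NNReal.coe_le_coe]
      change |(2 - 6 * y ^ 2) / (1 + y ^ 2) ^ 3| ≤ 6
      rw [abs_div, abs_of_nonneg (by positivity : 0 ≤ (1 + y ^ 2) ^ 3), div_le_iff₀ (by positivity),
        abs_le]
      have := sq_nonneg y
      have h2 := pow_nonneg this 2
      have h3 := pow_nonneg this 3
      constructor <;> nlinarith

lemma continuous_lyapunovDeriv : Continuous lyapunovDeriv := lipschitzWith_lyapunovDeriv.continuous

/-! ### Lipschitz paths and Barbalat's lemma -/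

lemma lipschitzOnWith_of_absolutelyContinuousOnInterval {y : ℝ → ℝ} {C : NNReal}
    (hac : ∀ T : ℝ, 0 < T → AbsolutelyContinuousOnInterval y 0 T)
    (hder : ∀ᵐ t ∂volume.restrict (Set.Ici (0 : ℝ)), |deriv y t| ≤ C) :
    LipschitzOnWith C y (Set.Ici 0) := by
  have key : ∀ s t : ℝ, 0 ≤ s → s < t → |y t - y s| ≤ C * |t - s| := by
    intro s t hs hst
    have hA : AbsolutelyContinuousOnInterval y s t :=
      (hac t (hs.trans_lt hst)).mono (by
        rw [Set.uIcc_of_le hst.le, Set.uIcc_of_le (hs.trans hst.le)]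
        exact Set.Icc_subset_Icc_left hs)
    rw [← hA.integral_deriv_eq_sub]
    refine intervalIntegral.norm_integral_le_of_norm_le_const_ae (f := deriv y) ?_
    rw [ae_restrict_iff' measurableSet_Ici] at hder
    filter_upwards [hder] with r hr hrm
    rw [Set.uIoc_of_le hst.le] at hrm
    exact hr (hs.trans hrm.1.le)
  refine LipschitzOnWith.of_dist_le_mul fun s hs t ht => ?_
  rw [Real.dist_eq, Real.dist_eq]
  rcases lt_trichotomy s t with h | rfl | h
  · rw [abs_sub_comm, abs_sub_comm s]; exact key s t hs h
  · simp
  · exact key t s ht h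

/-- **Barbalat's lemma**: a nonnegative Lipschitz function that is integrable on a half line
tends to zero. -/
lemma tendsto_zero_of_integrableOn_of_lipschitzOnWith {h : ℝ → ℝ} {K : NNReal}
    (h0 : ∀ t, 0 ≤ h t) (hK : LipschitzOnWith K h (Set.Ici 0))
    (hint : IntegrableOn h (Set.Ioi 0)) : Tendsto h atTop (𝓝 0) := by
  rw [Metric.tendsto_atTop]
  intro ε hε
  -- A window so short that `h` stays above ε/2 on it once `h t ≥ ε`; the `+ 1` covers K = 0.
  set η : ℝ := ε / (2 * (K + 1)) with hη
  have hηpos : 0 < η := by positivity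
  have hlim := intervalIntegral_tendsto_integral_Ioi 0 hint tendsto_id
  have hlim' := hlim.comp (tendsto_atTop_add_const_right atTop η tendsto_id)
  have hdiff := hlim'.sub hlim
  rw [sub_self] at hdiff
  have hev := hdiff.eventually_lt_const (show (0 : ℝ) < η * (ε / 2) by positivity)
  obtain ⟨N, hN⟩ := eventually_atTop.1 (hev.and (eventually_ge_atTop 0))
  refine ⟨N, fun t ht => ?_⟩
  obtain ⟨h1, ht0⟩ := hN t ht
  rw [Real.dist_0_eq_abs, abs_of_nonneg (h0 t)]
  by_contra hcon
  push Not at hcon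
  have hii : ∀ a b : ℝ, 0 ≤ a → 0 ≤ b → IntervalIntegrable h volume a b := fun a b ha hb =>
    intervalIntegrable_iff.2 (hint.mono_set fun r hr => lt_of_le_of_lt (le_min ha hb) hr.1)
  simp only [Function.comp, id] at h1
  rw [intervalIntegral.integral_interval_sub_left (hii _ _ le_rfl (by linarith))
    (hii _ _ le_rfl ht0)] at h1
  have h2 : ∫ _ in t..(t + η), (ε / 2) ≤ ∫ r in t..(t + η), h r := by
    refine intervalIntegral.integral_mono_on (by linarith) (by simp)
      (hii _ _ ht0 (by linarith)) fun r hr => ?_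
    have h3 := hK.dist_le_mul t ht0 r (ht0.trans hr.1)
    rw [Real.dist_eq, Real.dist_eq] at h3
    have h4 : |t - r| ≤ η := by rw [abs_le]; constructor <;> linarith [hr.1, hr.2]
    have h5 : (K : ℝ) * η ≤ ε / 2 := by
      rw [hη, ← mul_div_assoc, div_le_div_iff₀ (by positivity) (by positivity)]
      nlinarith [K.coe_nonneg]
    have h6 := (le_abs_self _).trans (h3.trans (mul_le_mul_of_nonneg_left h4 K.coe_nonneg))
    linarith
  rw [intervalIntegral.integral_const, smul_eq_mul, add_sub_cancel_left] at h2
  linarith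

/-! ### Pathwise analysis of the scalar relay -/

/-- The scalar differential inclusion `ẏ ∈ -w - δ Sgn y` on `[0, ∞)`, in the form of the facts
that its absolutely continuous solutions with velocities bounded by `C` satisfy. -/
structure IsRelaySolution (δ : ℝ) (C : NNReal) (w y : ℝ → ℝ) : Prop where
  lipschitz : LipschitzOnWith C y (Set.Ici 0)
  hasDerivAt : ∀ᵐ t ∂volume.restrict (Set.Ici (0 : ℝ)), ∃ d, HasDerivAt y d t ∧
    (y t ≠ 0 → d = -w t - δ * Real.sign (y t))

namespace IsRelaySolution

variable {δ : ℝ} {C : NNReal} {w y : ℝ → ℝ}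

lemma neg (h : IsRelaySolution δ C w y) : IsRelaySolution δ C (fun t => -w t) (fun t => -y t) where
  lipschitz := h.lipschitz.neg
  hasDerivAt := by
    filter_upwards [h.hasDerivAt] with t ⟨d, hd, hd'⟩
    refine ⟨-d, hd.neg, fun hne => ?_⟩
    rw [hd' (by simpa using hne), Real.sign_neg]
    ring

/-- At `y t = 0` the velocity is unspecified, but L'(0) = 0 makes its value irrelevant. -/
lemma lyapunov_sub_eq (h : IsRelaySolution δ C w y) {T : ℝ} (hT : 0 ≤ T) :
    lyapunov (y T) - lyapunov (y 0) =
      ∫ t in (0 : ℝ)..T, (-δ * |lyapunovDeriv (y t)| - lyapunovDeriv (y t) * w t) := by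
  have hL : LipschitzOnWith (1 * C) (lyapunov ∘ y) (Set.uIcc 0 T) :=
    lipschitzWith_lyapunov.comp_lipschitzOnWith (h.lipschitz.mono (by
      rw [Set.uIcc_of_le hT]; exact Set.Icc_subset_Ici_self))
  have hFTC := hL.absolutelyContinuousOnInterval.integral_deriv_eq_sub
  rw [Function.comp_def] at hFTC
  rw [← hFTC]
  refine intervalIntegral.integral_congr_ae ?_
  have hd := h.hasDerivAt
  rw [ae_restrict_iff' measurableSet_Ici] at hd
  filter_upwards [hd] with t ht htm
  rw [Set.uIoc_of_le hT] at htm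
  obtain ⟨d, hd, hd'⟩ := ht htm.1.le
  have hc := ((hasDerivAt_lyapunov (y t)).comp t hd).deriv
  rw [Function.comp_def] at hc
  rw [hc]
  by_cases hy : y t = 0
  · simp [hy, lyapunovDeriv]
  · rw [hd' hy, ← lyapunovDeriv_mul_sign]; ring

/-- A solution cannot stay positive if the time averages of `w` vanish. -/
lemma not_eventually_pos (h : IsRelaySolution δ C w y) (hδ : 0 < δ)
    (hw : ∀ T, 0 ≤ T → IntervalIntegrable w volume 0 T)
    (herg : Tendsto (fun T : ℝ => T⁻¹ * ∫ t in (0 : ℝ)..T, w t) atTop (𝓝 0))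
    {T₀ : ℝ} (hT₀ : 0 ≤ T₀) (hpos : ∀ t, T₀ ≤ t → 0 < y t) : False := by
  have key : ∀ T, T₀ ≤ T → (∫ t in (0 : ℝ)..T, w t) =
      (∫ t in (0 : ℝ)..T₀, w t) - (y T - y T₀) - δ * (T - T₀) := by
    intro T hT
    have hL : LipschitzOnWith C y (Set.uIcc T₀ T) := h.lipschitz.mono (by
      rw [Set.uIcc_of_le hT]; exact fun r hr => hT₀.trans hr.1)
    have hFTC := hL.absolutelyContinuousOnInterval.integral_deriv_eq_sub
    have hwi : IntervalIntegrable w volume T₀ T :=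
      (hw T₀ hT₀).symm.trans (hw T (hT₀.trans hT))
    have hcongr : ∫ t in T₀..T, deriv y t = ∫ t in T₀..T, (-w t - δ) := by
      refine intervalIntegral.integral_congr_ae ?_
      have hd := h.hasDerivAt
      rw [ae_restrict_iff' measurableSet_Ici] at hd
      filter_upwards [hd] with t ht htm
      rw [Set.uIoc_of_le hT] at htm
      obtain ⟨d, hd, hd'⟩ := ht (hT₀.trans htm.1.le)
      have hp := hpos t htm.1.le
      rw [hd.deriv, hd' hp.ne', Real.sign_of_pos hp, mul_one]
    rw [hcongr, intervalIntegral.integral_sub (f := fun t => -w t) hwi.neg (by simp),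
      intervalIntegral.integral_neg, intervalIntegral.integral_const, smul_eq_mul] at hFTC
    have hadd := intervalIntegral.integral_add_adjacent_intervals (hw T₀ hT₀) hwi
    linarith
  -- Dropping `-y T < 0` from `key` bounds the averages of `w` by `T⁻¹ * c - δ`, whose limit -δ is
  -- negative.
  set c : ℝ := (∫ t in (0 : ℝ)..T₀, w t) + y T₀ + δ * T₀ with hc
  have hupper : Tendsto (fun T : ℝ => T⁻¹ * c - δ) atTop (𝓝 (0 * c - δ)) :=
    (tendsto_inv_atTop_zero.mul_const c).sub_const δ
  have hle := le_of_tendsto_of_tendsto herg hupper (by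
    filter_upwards [eventually_ge_atTop T₀, eventually_gt_atTop 0] with T hT hTpos
    rw [key T hT]
    have hyT := hpos T hT
    have : T⁻¹ * c - δ = T⁻¹ * (c - δ * T) := by field_simp
    rw [this]
    refine mul_le_mul_of_nonneg_left ?_ (inv_nonneg.2 hTpos.le)
    rw [hc]; linarith)
  linarith

/-- The levels ±1 are barriers: |L'(±1)| = 1/2, so they are not hit once |L'(y)| < 1/2. A path
beyond a barrier would keep its sign forever, which `not_eventually_pos` excludes. -/
lemma tendsto_zero (h : IsRelaySolution δ C w y) (hδ : 0 < δ)
    (hw : ∀ T, 0 ≤ T → IntervalIntegrable w volume 0 T)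
    (herg : Tendsto (fun T : ℝ => T⁻¹ * ∫ t in (0 : ℝ)..T, w t) atTop (𝓝 0))
    (hint : IntegrableOn (fun t => |lyapunovDeriv (y t)|) (Set.Ioi 0)) :
    Tendsto y atTop (𝓝 0) := by
  have hlim : Tendsto (fun t => |lyapunovDeriv (y t)|) atTop (𝓝 0) :=
    tendsto_zero_of_integrableOn_of_lipschitzOnWith (fun _ => abs_nonneg _)
      (((lipschitzWith_one_norm (E := ℝ)).comp lipschitzWith_lyapunovDeriv).comp_lipschitzOnWith
        h.lipschitz) hint
  obtain ⟨N, hN⟩ := eventually_atTop.1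
    (hlim.eventually_lt_const (show (0 : ℝ) < 1 / 2 by norm_num))
  set T₀ := max N 0 with hT₀
  have hne : ∀ t, T₀ ≤ t → |y t| ≠ 1 := by
    intro t ht h1
    have h2 := hN t ((le_max_left _ _).trans ht)
    rw [abs_lyapunovDeriv, ← sq_abs (y t), h1] at h2
    norm_num at h2
  have hT₀0 : 0 ≤ T₀ := le_max_right _ _
  have hcont : ContinuousOn y (Set.Ici T₀) :=
    h.lipschitz.continuousOn.mono (Set.Ici_subset_Ici.2 hT₀0)
  have hnocross : ∀ c : ℝ, |c| = 1 → ∀ s t, T₀ ≤ s → T₀ ≤ t → y s < c → c < y t → False := by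
    intro c hc s t hs ht hsc hct
    obtain ⟨r, hr, hrc⟩ := (isPreconnected_Ici (a := T₀)).intermediate_value hs ht hcont
      (show c ∈ Set.Icc (y s) (y t) from ⟨hsc.le, hct.le⟩)
    exact hne r hr (by rw [hrc, hc])
  have hbelow : ∀ t, T₀ ≤ t → y t < 1 := by
    intro t ht
    by_contra hcon
    refine h.not_eventually_pos hδ hw herg hT₀0 fun s hs => ?_
    by_contra hs'
    refine hnocross 1 (by simp) s t hs ht (by linarith) ?_
    refine lt_of_le_of_ne (not_lt.1 hcon) fun h1 => hne t ht (by rw [← h1, abs_one])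
  have habove : ∀ t, T₀ ≤ t → -1 < y t := by
    intro t ht
    by_contra hcon
    refine h.neg.not_eventually_pos hδ (fun T hT => (hw T hT).neg) (by
      simpa [intervalIntegral.integral_neg] using herg.neg) hT₀0 fun s hs => ?_
    by_contra hs'
    refine hnocross (-1) (by simp) t s ht hs ?_ (by linarith)
    refine lt_of_le_of_ne (not_lt.1 hcon) fun h1 => hne t ht (by rw [h1]; simp)
  have hlim2 : Tendsto (fun t => 2 * |lyapunovDeriv (y t)|) atTop (𝓝 0) := by
    simpa using hlim.const_mul 2
  -- On [-1, 1] one has (1 + y²)² ≤ 4, hence |y| ≤ 2|L'(y)|.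
  refine squeeze_zero_norm' ?_ hlim2
  filter_upwards [eventually_ge_atTop T₀] with t ht
  have h1 : |y t| ≤ 1 := abs_le.2 ⟨(habove t ht).le, (hbelow t ht).le⟩
  rw [Real.norm_eq_abs, abs_lyapunovDeriv, ← mul_div_assoc, le_div_iff₀ (by positivity),
    ← sq_abs (y t)]
  have h2 : (1 + |y t| ^ 2) ^ 2 ≤ 2 ^ 2 :=
    pow_le_pow_left₀ (by positivity) (by nlinarith [abs_nonneg (y t)]) 2
  nlinarith [abs_nonneg (y t)]

end IsRelaySolution

/-! ### Rank of the flow matrix -/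

lemma flowMatrix_mulVec_apply {n : ℕ} (u : ControlIndex n → ℝ) (S : Coalition n) :
    (flowMatrix n *ᵥ u) S = (∑ i ∈ S.1, u (Sum.inl i)) -
      if h : S.1 ≠ Finset.univ then u (Sum.inr ⟨S, h⟩) else 0 := by
  rw [flowMatrix, Matrix.fromCols_mulVec, Pi.add_apply, sub_eq_add_neg]
  congr 1
  · simp [incidenceMatrix, Matrix.mulVec, dotProduct]
  · simp only [surplusMatrix, Matrix.mulVec, dotProduct, Matrix.of_apply, ite_mul, zero_mul,
      neg_mul, one_mul, Function.comp]
    split_ifs with h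
    · rw [Finset.sum_eq_single (⟨S, h⟩ : ProperCoalition n)]
      · simp
      · intro T _ hT
        exact if_neg fun hS => hT (Subtype.ext hS.symm)
      · simp
    · rw [neg_zero]
      refine Finset.sum_eq_zero fun T _ => if_neg ?_
      rintro rfl
      exact h T.2

/-- The flow matrix has full row rank. -/
lemma flowMatrix_mulVec_surjective (n : ℕ) :
    Function.Surjective fun u : ControlIndex n → ℝ => flowMatrix n *ᵥ u := by
  intro y
  rcases isEmpty_or_nonempty (Fin n) with hn | ⟨⟨i₀⟩⟩
  · exact ⟨0, funext fun S => isEmptyElim S.2.choose⟩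
  -- Only the row of `N` has no surplus variable: one player receives `y N`, and the surpluses
  -- adjust the other rows.
  let N : Coalition n := ⟨Finset.univ, i₀, Finset.mem_univ _⟩
  let a : Fin n → ℝ := Pi.single i₀ (y N)
  refine ⟨Sum.elim a fun T => (∑ i ∈ T.1.1, a i) - y T.1, funext fun S => ?_⟩
  dsimp only
  rw [flowMatrix_mulVec_apply]
  simp only [Sum.elim_inl, Sum.elim_inr]
  split_ifs with h
  · ring
  · rw [not_not] at h
    have hS : S = N := Subtype.ext h
    subst hS
    simp [N, a]

lemma IsPseudoInverse.mulVec_mulVec {ι κ : Type*} [Fintype ι] [Fintype κ] {A : Matrix ι κ ℝ}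
    {G : Matrix κ ι ℝ} (h : IsPseudoInverse A G)
    (hA : Function.Surjective fun u : κ → ℝ => A *ᵥ u) (y : ι → ℝ) : A *ᵥ (G *ᵥ y) = y := by
  obtain ⟨u, rfl⟩ := hA y
  simp only [Matrix.mulVec_mulVec, ← Matrix.mul_assoc]
  rw [h]

/-! ### Filippov regularization of the relay field -/

lemma filippovSet_subset {ι : Type*} [Fintype ι] {f : (ι → ℝ) → ι → ℝ} {x : ι → ℝ} {ρ : ℝ}
    (hρ : 0 < ρ) {K : Set (ι → ℝ)} (hK : IsClosed K) (hK' : Convex ℝ K)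
    (hf : ∀ y ∈ Metric.ball x ρ, f y ∈ K) : filippovSet f x ⊆ K := by
  intro w hw
  simp only [filippovSet, Set.mem_iInter] at hw
  refine closure_minimal (convexHull_min ?_ hK') hK (hw ρ hρ ∅ measure_empty)
  rintro _ ⟨y, hy, rfl⟩
  exact hf y hy.1

lemma Real.sign_eq_of_abs_sub_lt {x y : ℝ} (h : |y - x| < |x|) : Real.sign y = Real.sign x := by
  rcases lt_trichotomy x 0 with hx | rfl | hx
  · rw [abs_of_neg hx, abs_lt] at h
    rw [Real.sign_of_neg hx, Real.sign_of_neg (by linarith)]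
  · simp at h
    exact absurd h (not_lt.2 (abs_nonneg _))
  · rw [abs_of_pos hx, abs_lt] at h
    rw [Real.sign_of_pos hx, Real.sign_of_pos (by linarith)]

lemma abs_sign_le_one (y : ℝ) : |Real.sign y| ≤ 1 := by
  rcases Real.sign_apply_eq y with h | h | h <;> simp [h]

section RelayFilippov

variable {ι : Type*} [Fintype ι] {c x d : ι → ℝ} {δ : ℝ}

/-- On the ball of radius |x i| the sign of coordinate `i` is constant, so the field stays in a
hyperplane there. -/
lemma filippovSet_relay_apply (hd : d ∈ filippovSet (fun y => c - δ • sgnVec y) x) (i : ι)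
    (hx : x i ≠ 0) : d i = c i - δ * Real.sign (x i) := by
  refine filippovSet_subset (abs_pos.2 hx) (K := {z | z i = c i - δ * Real.sign (x i)})
    (isClosed_eq (continuous_apply i) continuous_const)
    (convex_hyperplane (LinearMap.proj (R := ℝ) (φ := fun _ : ι => ℝ) i).isLinear _)
    (fun y hy => ?_) hd
  have h : |y i - x i| < |x i| := (dist_le_pi_dist y x i).trans_lt hy
  simp [sgnVec, Real.sign_eq_of_abs_sub_lt h]

lemma filippovSet_relay_abs_le (hδ : 0 ≤ δ) (hd : d ∈ filippovSet (fun y => c - δ • sgnVec y) x)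
    (i : ι) : |d i - c i| ≤ δ := by
  refine filippovSet_subset one_pos (K := (fun z : ι → ℝ => z i) ⁻¹' Metric.closedBall (c i) δ)
    (Metric.isClosed_closedBall.preimage (continuous_apply i))
    ((convex_closedBall (c i) δ).linear_preimage
      (LinearMap.proj (R := ℝ) (φ := fun _ : ι => ℝ) i))
    (fun y _ => ?_) hd
  have h := mul_le_mul_of_nonneg_left (abs_sign_le_one (y i)) hδ
  simpa [Real.dist_eq, sgnVec, abs_mul, abs_of_nonneg hδ] using h

end RelayFilippov

lemma AbsolutelyContinuousOnInterval.eval {ι : Type*} [Fintype ι] {x : ℝ → ι → ℝ} {a b : ℝ}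
    (h : AbsolutelyContinuousOnInterval x a b) (i : ι) :
    AbsolutelyContinuousOnInterval (fun t => x t i) a b :=
  squeeze_zero (fun _ => Finset.sum_nonneg fun _ _ => dist_nonneg)
    (fun _ => Finset.sum_le_sum fun _ _ => dist_le_pi_dist _ _ i) h

/-- The coordinates of a Filippov solution of `ẋ = c(t) - δ sgn x` solve scalar relay inclusions. -/
lemma IsFilippovSolution.isRelaySolution {ι : Type*} [Fintype ι] {w x : ℝ → ι → ℝ} {δ : ℝ}
    {C : NNReal} (hδ : 0 ≤ δ)
    (h : IsFilippovSolution (fun t y => -w t - δ • sgnVec y) x) (i : ι)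
    (hw : ∀ᵐ t ∂volume.restrict (Set.Ici (0 : ℝ)), |w t i| ≤ C) :
    IsRelaySolution δ (C + δ.toNNReal) (fun t => w t i) (fun t => x t i) where
  lipschitz := by
    refine lipschitzOnWith_of_absolutelyContinuousOnInterval (fun T hT => (h.1 T hT).eval i) ?_
    filter_upwards [h.2, hw] with t ⟨d, hd, hd'⟩ hwt
    rw [(hasDerivAt_pi.1 hd' i).deriv]
    have h1 := filippovSet_relay_abs_le hδ hd i
    have h2 : d i = (d i - (-w t) i) + -w t i := by simp
    rw [h2]
    refine (abs_add_le _ _).trans ?_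
    rw [abs_neg, NNReal.coe_add, Real.coe_toNNReal δ hδ, add_comm]
    exact add_le_add hwt h1
  hasDerivAt := by
    filter_upwards [h.2] with t ⟨d, hd, hd'⟩
    exact ⟨d i, hasDerivAt_pi.1 hd' i, fun hne => filippovSet_relay_apply hd i hne⟩

/-! ### Expectation estimate and almost sure convergence -/

section Stochastic

variable {Ω : Type*} [MeasurableSpace Ω] {μ : Measure Ω}

/-- A process with measurable marginals and almost surely continuous paths on `[0, ∞)` has a jointly
measurable modification with the same paths on `[0, ∞)`. -/
lemma exists_measurable_uncurry_of_ae_continuousOn {x : ℝ → Ω → ℝ}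
    (hx : ∀ t, 0 ≤ t → Measurable (x t))
    (hcont : ∀ᵐ ω ∂μ, ContinuousOn (fun t => x t ω) (Set.Ici 0)) :
    ∃ z : ℝ → Ω → ℝ, Measurable (Function.uncurry z) ∧ ∀ᵐ ω ∂μ, ∀ t, 0 ≤ t → z t ω = x t ω := by
  classical
  obtain ⟨N, hsub, hN, hμN⟩ := exists_measurable_superset_of_null (ae_iff.1 hcont)
  refine ⟨fun t ω => if ω ∈ N then 0 else x (max t 0) ω, ?_, ?_⟩
  · refine measurable_uncurry_of_continuous_of_measurable (fun ω => ?_) fun t =>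
      Measurable.ite hN measurable_const (hx _ (le_max_right _ _))
    by_cases hω : ω ∈ N
    · simpa [hω] using continuous_const
    · have hc : ContinuousOn (fun t => x t ω) (Set.Ici 0) := by
        by_contra hcon
        exact hω (hsub hcon)
      simpa [hω, Function.comp_def] using hc.comp_continuous (continuous_id.max continuous_const)
        fun t => le_max_right t 0
  · filter_upwards [compl_mem_ae_iff.2 hμN] with ω hω t ht
    rw [if_neg hω, max_eq_left ht]

variable [IsProbabilityMeasure μ]

/-- Fubini turns an almost sure bound at each fixed time into a bound along almost every path. -/
lemma ae_ae_abs_le {w : ℝ → Ω → ℝ} {K : ℝ} (hw : Measurable (Function.uncurry w))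
    (hwK : ∀ t, 0 ≤ t → ∀ᵐ ω ∂μ, |w t ω| ≤ K) :
    ∀ᵐ ω ∂μ, ∀ᵐ t ∂volume.restrict (Set.Ici (0 : ℝ)), |w t ω| ≤ K := by
  refine (Measure.ae_ae_comm (p := fun t ω => |w t ω| ≤ K)
    (measurableSet_le (continuous_abs.measurable.comp hw) measurable_const)).1 ?_
  rw [ae_restrict_iff' measurableSet_Ici]
  exact Eventually.of_forall hwK

/-- If `x t` is independent of the bounded centred input `w t` at each time, then the expected
total time integral of `|lyapunovDeriv x|` is finite. -/
lemma integrable_abs_lyapunovDeriv {w z : ℝ → Ω → ℝ} {δ : ℝ} {C : NNReal} {K : ℝ}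
    (hδ : 0 < δ) (hw : Measurable (Function.uncurry w))
    (hwK : ∀ t, 0 ≤ t → ∀ᵐ ω ∂μ, |w t ω| ≤ K) (hmean : ∀ t, 0 ≤ t → ∫ ω, w t ω ∂μ = 0)
    (hz : Measurable (Function.uncurry z))
    (hsol : ∀ᵐ ω ∂μ, IsRelaySolution δ C (fun t => w t ω) (fun t => z t ω))
    (hindep : ∀ t, 0 ≤ t → IndepFun (z t) (w t) μ) :
    Integrable (fun p : ℝ × Ω => |lyapunovDeriv (z p.1 p.2)|)
      ((volume.restrict (Set.Ioi 0)).prod μ) := by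
  have hL : Measurable fun p : ℝ × Ω => lyapunovDeriv (z p.1 p.2) :=
    continuous_lyapunovDeriv.measurable.comp hz
  have hzt : ∀ t, Measurable (z t) := fun t => hz.comp measurable_prodMk_left
  have hwt : ∀ t, Measurable (w t) := fun t => hw.comp measurable_prodMk_left
  have hLt : ∀ t, Measurable fun ω => lyapunovDeriv (z t ω) := fun t =>
    continuous_lyapunovDeriv.measurable.comp (hzt t)
  have hLint : ∀ t, Integrable (fun ω => |lyapunovDeriv (z t ω)|) μ := fun t =>
    Integrable.of_bound (hLt t).norm.aestronglyMeasurable 1 (Eventually.of_forall fun ω => by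
      rw [Real.norm_eq_abs, abs_abs]; exact abs_lyapunovDeriv_le_one _)
  have hG : StronglyMeasurable fun t => ∫ ω, |lyapunovDeriv (z t ω)| ∂μ :=
    (hL.norm.stronglyMeasurable).integral_prod_right'
  have hprod : ∀ t, 0 ≤ t → Integrable (fun ω => lyapunovDeriv (z t ω) * w t ω) μ := by
    intro t ht
    refine Integrable.of_bound ((hLt t).mul (hwt t)).aestronglyMeasurable K ?_
    filter_upwards [hwK t ht] with ω hω
    rw [norm_mul]
    calc ‖lyapunovDeriv (z t ω)‖ * ‖w t ω‖ ≤ 1 * K :=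
          mul_le_mul (abs_lyapunovDeriv_le_one _) hω (norm_nonneg _) zero_le_one
      _ = K := one_mul K
  -- Independence and centring enter here, at a single time.
  have hzero : ∀ t, 0 ≤ t → ∫ ω, lyapunovDeriv (z t ω) * w t ω ∂μ = 0 := by
    intro t ht
    have hi : IndepFun (fun ω => lyapunovDeriv (z t ω)) (w t) μ :=
      (hindep t ht).comp continuous_lyapunovDeriv.measurable measurable_id
    have h := hi.integral_mul_eq_mul_integral (hLt t).aestronglyMeasurable
      (hwt t).aestronglyMeasurable
    rw [hmean t ht, mul_zero] at h
    exact h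
  have hbound : ∀ T, 0 ≤ T → ∫ t in (0 : ℝ)..T, ‖∫ ω, |lyapunovDeriv (z t ω)| ∂μ‖ ≤ δ⁻¹ := by
    intro T hT
    let F : ℝ → Ω → ℝ := fun t ω => δ * |lyapunovDeriv (z t ω)| + lyapunovDeriv (z t ω) * w t ω
    have hFm : Measurable (Function.uncurry F) := (hL.norm.const_mul δ).add (hL.mul hw)
    have hFint : Integrable (Function.uncurry F) ((volume.restrict (Set.uIoc 0 T)).prod μ) := by
      rw [Set.uIoc_of_le hT]
      refine Integrable.of_bound hFm.aestronglyMeasurable (δ * 1 + 1 * K) ?_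
      have hset : MeasurableSet {p : ℝ × Ω | |w p.1 p.2| ≤ K} :=
        measurableSet_le (continuous_abs.measurable.comp hw) measurable_const
      have hae : ∀ᵐ p ∂(volume.restrict (Set.Ioc 0 T)).prod μ, |w p.1 p.2| ≤ K := by
        rw [Measure.ae_prod_iff_ae_ae hset, ae_restrict_iff' measurableSet_Ioc]
        exact Eventually.of_forall fun t ht => hwK t ht.1.le
      filter_upwards [hae] with p hp
      refine (norm_add_le _ _).trans (add_le_add ?_ ?_)
      · rw [norm_mul, Real.norm_eq_abs, Real.norm_eq_abs, abs_abs, abs_of_pos hδ]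
        exact mul_le_mul_of_nonneg_left (abs_lyapunovDeriv_le_one _) hδ.le
      · rw [norm_mul]
        exact mul_le_mul (abs_lyapunovDeriv_le_one _) hp (norm_nonneg _) zero_le_one
    have hle : ∫ ω, (∫ t in (0 : ℝ)..T, F t ω) ∂μ ≤ 1 := by
      have h1 : ∀ᵐ ω ∂μ, ∫ t in (0 : ℝ)..T, F t ω ≤ 1 := by
        filter_upwards [hsol] with ω hω
        have h2 := hω.lyapunov_sub_eq hT
        have h3 : ∫ t in (0 : ℝ)..T, F t ω = -(lyapunov (z T ω) - lyapunov (z 0 ω)) := by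
          rw [h2, ← intervalIntegral.integral_neg]
          congr 1
          ext t
          simp only [F]
          ring
        rw [h3]
        linarith [lyapunov_nonpos (z 0 ω), neg_one_le_lyapunov (z T ω)]
      have h4 : Integrable (fun ω => ∫ t in (0 : ℝ)..T, F t ω) μ := by
        simp_rw [intervalIntegral.integral_of_le hT]
        rw [Set.uIoc_of_le hT] at hFint
        exact hFint.integral_prod_right
      calc ∫ ω, (∫ t in (0 : ℝ)..T, F t ω) ∂μ ≤ ∫ _, (1 : ℝ) ∂μ :=
            integral_mono_ae h4 (integrable_const _) h1
        _ = 1 := by simp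
    rw [← intervalIntegral_integral_swap hFint] at hle
    have hcongr : ∫ t in (0 : ℝ)..T, ∫ ω, F t ω ∂μ =
        ∫ t in (0 : ℝ)..T, δ * ‖∫ ω, |lyapunovDeriv (z t ω)| ∂μ‖ := by
      refine intervalIntegral.integral_congr fun t ht => ?_
      rw [Set.uIcc_of_le hT] at ht
      simp only [F]
      rw [integral_add ((hLint t).const_mul δ) (hprod t ht.1), hzero t ht.1, add_zero,
        integral_const_mul, Real.norm_of_nonneg (integral_nonneg fun _ => abs_nonneg _)]
    rw [hcongr, intervalIntegral.integral_const_mul] at hle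
    rwa [← one_div, le_div_iff₀ hδ, mul_comm]
  have hGint : IntegrableOn (fun t => ∫ ω, |lyapunovDeriv (z t ω)| ∂μ) (Set.Ioi 0) := by
    refine integrableOn_Ioi_of_intervalIntegral_norm_bounded δ⁻¹ 0 (fun T : ℝ => ?_) tendsto_id
      ((eventually_ge_atTop 0).mono hbound)
    refine Integrable.of_bound hG.aestronglyMeasurable 1 (Eventually.of_forall fun t => ?_)
    rw [Real.norm_of_nonneg (integral_nonneg fun _ => abs_nonneg _)]
    calc ∫ ω, |lyapunovDeriv (z t ω)| ∂μ ≤ ∫ _, (1 : ℝ) ∂μ :=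
          integral_mono (hLint t) (integrable_const _) fun _ => abs_lyapunovDeriv_le_one _
      _ = 1 := by simp
  refine (integrable_prod_iff (f := fun p : ℝ × Ω => |lyapunovDeriv (z p.1 p.2)|)
    hL.norm.aestronglyMeasurable).2 ⟨Eventually.of_forall hLint, ?_⟩
  simpa [IntegrableOn] using hGint

/-- Almost sure convergence for the scalar relay inclusion driven by a bounded, centred, mean
ergodic input that at each time is independent of the state. -/
theorem ae_tendsto_zero_of_isRelaySolution {w x : ℝ → Ω → ℝ} {δ : ℝ} {C : NNReal} {K : ℝ}
    (hδ : 0 < δ) (hw : Measurable (Function.uncurry w))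
    (hwK : ∀ t, 0 ≤ t → ∀ᵐ ω ∂μ, |w t ω| ≤ K) (hmean : ∀ t, 0 ≤ t → ∫ ω, w t ω ∂μ = 0)
    (herg : ∀ᵐ ω ∂μ, Tendsto (fun T : ℝ => T⁻¹ * ∫ t in (0 : ℝ)..T, w t ω) atTop (𝓝 0))
    (hx : ∀ t, 0 ≤ t → Measurable (x t))
    (hsol : ∀ᵐ ω ∂μ, IsRelaySolution δ C (fun t => w t ω) (fun t => x t ω))
    (hindep : ∀ t, 0 ≤ t → IndepFun (x t) (w t) μ) :
    ∀ᵐ ω ∂μ, Tendsto (fun t => x t ω) atTop (𝓝 0) := by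
  -- Fubini needs joint measurability, while `x` is only measurable at each time.
  obtain ⟨z, hz, hzx⟩ := exists_measurable_uncurry_of_ae_continuousOn hx
    (hsol.mono fun ω hω => hω.lipschitz.continuousOn)
  have hsolz : ∀ᵐ ω ∂μ, IsRelaySolution δ C (fun t => w t ω) (fun t => z t ω) := by
    filter_upwards [hsol, hzx] with ω hω hzω
    refine ⟨fun s hs t ht => ?_, ?_⟩
    · simpa only [hzω s hs, hzω t ht] using hω.lipschitz hs ht
    · have h := hω.hasDerivAt
      -- Time 0 is discarded: `z` and `x` may differ at negative times, so a two-sided derivative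
      -- transfers only for t > 0.
      rw [← Measure.restrict_congr_set Ioi_ae_eq_Ici, ae_restrict_iff' measurableSet_Ioi] at h ⊢
      filter_upwards [h] with t h' ht
      obtain ⟨d, hd, hd'⟩ := h' ht
      refine ⟨d, hd.congr_of_eventuallyEq ?_, ?_⟩
      · filter_upwards [lt_mem_nhds ht] with r hr using hzω r (le_of_lt hr)
      · rwa [hzω t (le_of_lt ht)]
  have hindepz : ∀ t, 0 ≤ t → IndepFun (z t) (w t) μ := fun t ht =>
    (hindep t ht).congr (hzx.mono fun ω h => (h t ht).symm) EventuallyEq.rfl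
  have hint := (integrable_abs_lyapunovDeriv hδ hw hwK hmean hz hsolz hindepz).prod_left_ae
  filter_upwards [hint, hsolz, herg, hzx, ae_ae_abs_le hw hwK] with ω h1 h2 h3 h4 h5
  have hwint : ∀ T, 0 ≤ T → IntervalIntegrable (fun t => w t ω) volume 0 T := fun T hT => by
    rw [intervalIntegrable_iff_integrableOn_Ioc_of_le hT]
    exact Integrable.of_bound (hw.comp measurable_prodMk_right).aestronglyMeasurable K
      (ae_restrict_of_ae_restrict_of_subset (fun t ht => ht.1.le) h5)
  refine (h2.tendsto_zero hδ hwint h3 h1).congr' ?_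
  filter_upwards [eventually_ge_atTop 0] with t ht using h4 t ht

end Stochastic

/-! ### Closed loop and reduction to coordinates -/

lemma flowMatrix_mulVec_signControl {n : ℕ} {unom : ControlIndex n → ℝ} {vnom : Coalition n → ℝ}
    (hunom : flowMatrix n *ᵥ unom = vnom) {Bdag : Matrix (ControlIndex n) (Coalition n) ℝ}
    (hBdag : IsPseudoInverse (flowMatrix n) Bdag) (δ : ℝ) (y : Coalition n → ℝ) :
    flowMatrix n *ᵥ signControl unom δ Bdag y = vnom - δ • sgnVec y := by
  rw [signControl, Matrix.mulVec_sub, Matrix.mulVec_smul, hunom,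
    hBdag.mulVec_mulVec (flowMatrix_mulVec_surjective n)]

end

theorem theorem2 {Ω : Type*} [MeasurableSpace Ω] (μ : Measure Ω) [IsProbabilityMeasure μ]
    (n : ℕ)
    -- the flow of random games, a bounded mean ergodic process
    (V : Set (Coalition n → ℝ)) (v : ℝ → Ω → Coalition n → ℝ) (vnom : Coalition n → ℝ)
    (hv : IsBoundedMeanErgodic μ V v vnom)
    -- the feasible nominal control, the pseudo-inverse, and the gain of the controller
    (amin amax : Fin n → ℝ) (unom : ControlIndex n → ℝ)
    (hunom : flowMatrix n *ᵥ unom = vnom)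
    (Bdag : Matrix (ControlIndex n) (Coalition n) ℝ)
    (hBdag : IsPseudoInverse (flowMatrix n) Bdag)
    (δ : ℝ) (hδ : 0 < δ)
    (hU : ∀ y : Coalition n → ℝ, signControl unom δ Bdag y ∈ feasibleControls amin amax)
    -- the state, a random process solving `ẋ = B u - v` with `u = u_nom - δ B† sgn(x)`
    (x : ℝ → Ω → Coalition n → ℝ)
    (hx_meas : ∀ t, 0 ≤ t → Measurable (x t))
    (hx_sol : ∀ᵐ ω ∂μ, IsFilippovSolution
      (fun t y => flowMatrix n *ᵥ signControl unom δ Bdag y - v t ω) (fun t => x t ω))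
    -- at each time the state is independent of the fluctuation of the coalitions' values
    (hindep : ∀ t, 0 ≤ t → IndepFun (x t) (fun ω => v t ω - vnom) μ) :
    ∀ᵐ ω ∂μ, Tendsto (fun t => x t ω) atTop (𝓝 0) := by
  obtain ⟨P, hP, hPV, hlaw⟩ := hv.law
  obtain ⟨R, hR⟩ := hv.bounded.subset_closedBall 0
  have hvt : ∀ t, Measurable (v t) := fun t => hv.measurable.comp measurable_prodMk_left
  have hvR : ∀ t, 0 ≤ t → ∀ᵐ ω ∂μ, ∀ i, |v t ω i| ≤ R := by
    intro t ht
    rw [← hlaw t ht] at hPV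
    filter_upwards [ae_of_ae_map (hvt t).aemeasurable hPV] with ω hω i
    have h := hR hω
    rw [mem_closedBall_zero_iff] at h
    exact (norm_le_pi_norm (v t ω) i).trans h
  have hvint : ∀ t, 0 ≤ t → ∀ i, Integrable (fun ω => v t ω i) μ := fun t ht i =>
    Integrable.of_bound ((measurable_pi_apply i).comp (hvt t)).aestronglyMeasurable R
      ((hvR t ht).mono fun ω hω => hω i)
  have hvi : ∀ i, Measurable (Function.uncurry fun t ω => v t ω i) := fun i =>
    (measurable_pi_apply i).comp hv.measurable
  suffices h : ∀ i, ∀ᵐ ω ∂μ, Tendsto (fun t => x t ω i) atTop (𝓝 0) by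
    filter_upwards [ae_all_iff.2 h] with ω hω
    exact tendsto_pi_nhds.2 hω
  intro i
  have hwm : Measurable (Function.uncurry fun t ω => v t ω i - vnom i) := (hvi i).sub_const _
  have hwK : ∀ t, 0 ≤ t → ∀ᵐ ω ∂μ, |v t ω i - vnom i| ≤ ((R + |vnom i|).toNNReal : ℝ) := by
    intro t ht
    filter_upwards [hvR t ht] with ω hω
    exact ((abs_sub _ _).trans (add_le_add_left (hω i) _)).trans (Real.le_coe_toNNReal _)
  refine ae_tendsto_zero_of_isRelaySolution hδ hwm hwK (fun t ht => ?_) ?_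
    (fun t ht => (measurable_pi_apply i).comp (hx_meas t ht))
    (C := (R + |vnom i|).toNNReal + δ.toNNReal) ?_ fun t ht =>
      (hindep t ht).comp (measurable_pi_apply i) (measurable_pi_apply i)
  · rw [integral_sub (hvint t ht i) (integrable_const _), ← eval_integral (hvint t ht),
      hv.mean t ht]
    simp
  · have hbd : ∀ᵐ ω ∂μ, ∀ j, ∀ᵐ t ∂volume.restrict (Set.Ici (0 : ℝ)), |v t ω j| ≤ R :=
      ae_all_iff.2 fun j => ae_ae_abs_le (hvi j) fun t ht => (hvR t ht).mono fun ω hω => hω j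
    filter_upwards [hv.ergodic, hbd] with ω herg hω
    -- Integrability of every coordinate lets the vector-valued time integral be evaluated
    -- coordinatewise.
    have hint : ∀ T, 0 ≤ T → ∀ j, Integrable (fun t => v t ω j) (volume.restrict (Set.Ioc 0 T)) :=
      fun T _ j => Integrable.of_bound
        ((hvi j).comp measurable_prodMk_right).aestronglyMeasurable R
        (ae_restrict_of_ae_restrict_of_subset (fun t ht => ht.1.le) (hω j))
    have hlim := (tendsto_pi_nhds.1 herg i).sub_const (vnom i)
    rw [sub_self] at hlim
    refine hlim.congr' ?_
    filter_upwards [eventually_gt_atTop 0] with T hT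
    simp only [intervalIntegral.integral_of_le hT.le, Pi.smul_apply, smul_eq_mul]
    rw [eval_integral (hint T hT.le), integral_sub (hint T hT.le i) (integrable_const _),
      mul_sub, setIntegral_const, smul_eq_mul]
    simp [hT.le, hT.ne']
  · filter_upwards [hx_sol, ae_ae_abs_le hwm hwK] with ω hω hωK
    refine IsFilippovSolution.isRelaySolution (w := fun t => v t ω - vnom) hδ.le ?_ i hωK
    convert hω using 3 with t y
    rw [flowMatrix_mulVec_signControl hunom hBdag]
    abel
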